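/- **Setting.** Fix integers $d\ge 1$ and $n\ge 2$. A cube is a set $Q=\prod_{s=1}^d[c_s,c_s+\ell)\subset\mathbb R^d$ with sidelength $\ell(Q)=\ell>0$. For $i=1,\dots,d+1$ let $\delta_i\in\mathbb R^d$ and let $\mathbf a_i=(\vec a_{i,0},\vec a_{i,1},\dots)$ with $\vec a_{i,r}\in\{0,\dots,n-1\}^d$; put $\mathcal L_{\mathbf a_i}(j)=\sum_{r=0}^{j-1}n^r\vec a_{i,r}\in\mathbb Z^d$ (so $\mathcal L_{\mathbf a_i}(0)=0$). The grid $\mathcal G_i=\mathcal G(\delta_i,\mathcal L_{\mathbf a_i})$ is the collection of all cubes of all generations $m\in\mathbb Z$, where the $m$-th generation $\mathcal G_{i,m}$ consists of the cubes of sidelength $n^{-m}$ with corners $\delta_i+k/n^m$ if $m\ge0$, and $\delta_i+\mathcal L_{\mathbf a_i}(-m)+k/n^m$ if $m<0$, $k\in\mathbb Z^d$. The grids $\mathcal G_1,\dots,\mathcal G_{d+1}$ are *adjacent* if there is a constant $C$ such that every cube $Q$ is contained in some $R\in\mathcal G_1\cup\dots\cup\mathcal G_{d+1}$ with $\ell(R)\le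 C\,\ell(Q)$. Let $b[\mathcal F]$ be the union of the topological boundaries of the cubes of a collection $\mathcal F$, $\operatorname{dist}(A,B)=\inf_{x\in A,\,y\in B}\|x-y\|$ (Euclidean norm), and $\operatorname{dev}(A,x)=\max_{1\le k\le d}\inf\{|t|:x+t\vec e_k\in A\}$. Vectors $v_1,\dots,v_l\in\mathbb R^d$ are *separated* if $(v_p)_s-(v_q)_s\notin\mathbb Z$ for all $p\ne q$ and all $1\le s\le d$. For each $i$ put - $\mathfrak L_i(m)=\bigcap_{k\ne i}b[\mathcal G_{k,m}]$, $m\ge0$ (the small scale lattice of the other $d$ vectors); - $M_i(j)=b[\mathcal G_{i,-j}]\cap[0,n^j)^d$ (the $j$-th modulated corner set); - $S_i(j)=\Big(\bigcap_{k\ne i}b[\mathcal G_{k,-j}]\Big)\cap[0,n^j)^d$ (the large scale sampling of the other $d$ grids). Call $\delta_i$ *$n$-far with respect to the small scale lattice of the others* if $(\delta_k)_{k\ne i}$ are separated and there is $C>0$ with $\operatorname{dist}(b[\mathcal G_{i,m}],\mathfrak L_i(m))\ge C/n^m$ for all $m\ge0$. **Theorem.** The grids $\mathcal G_1,\dots,\mathcal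 G_{d+1}$ are adjacent if and only if both of the following hold. (i) For each $i\in\{1,\dots,d+1\}$, $\delta_i$ is $n$-far with respect to the small scale lattice of the other $d$ vectors. (ii) For each $i\in\{1,\dots,d+1\}$, $$0<\liminf_{j\to\infty}\frac{\operatorname{dist}(M_i(j),S_i(j))}{n^j}\le\limsup_{j\to\infty}\frac{\sup_{y'\in S_i(j)}\operatorname{dev}(M_i(j),y')}{n^j}<1.$$ Moreover, for each $i$ for which the vectors $(\delta_k)_{k\ne i}$ are separated (in particular whenever (i) holds) and each $j>0$, the set $S_i(j)$ is finite and nonempty, so that the supremum in (ii) is an attained maximum. -/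

import Mathlib

noncomputable section

namespace NAdic

/-- A cube `[c₁, c₁ + ℓ) × ⋯ × [c_d, c_d + ℓ)` in `ℝᵈ`, given by its corner `c` and its
sidelength `ℓ > 0`. -/
structure Cube (d : ℕ) where
  corner : EuclideanSpace ℝ (Fin d)
  side : ℝ
  side_pos : 0 < side

/-- The points of a cube (left-closed and right-open). -/
def Cube.toSet {d : ℕ} (Q : Cube d) : Set (EuclideanSpace ℝ (Fin d)) :=
  {x | ∀ s, Q.corner s ≤ x s ∧ x s < Q.corner s + Q.side}

/-- A family of `d + 1` collections of cubes is adjacent if every cube `Q` lies in some cube `R`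
of one of the collections, with `ℓ(R) ≤ C ℓ(Q)`, where `C` does not depend on `Q`. -/
def Adjacent {d : ℕ} (G : Fin (d + 1) → Set (Cube d)) : Prop :=
  ∃ C : ℝ, ∀ Q : Cube d, ∃ i, ∃ R ∈ G i, Q.toSet ⊆ R.toSet ∧ R.side ≤ C * Q.side

/-- The location function `j ↦ ∑_{i < j} nⁱ aᵢ` of the infinite matrix `a = (a₀, a₁, …)` with
columns `aᵢ ∈ {0, …, n - 1}ᵈ`; it vanishes at `j = 0`. -/
def location {d n : ℕ} (a : ℕ → Fin d → Fin n) (j : ℕ) (s : Fin d) : ℤ :=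
  ∑ i ∈ Finset.range j, (n : ℤ) ^ i * ((a i s : ℕ) : ℤ)

/-- The cubes of sidelength `n⁻ᵐ` whose corners are the points `p + k / nᵐ`, `k ∈ ℤᵈ`.
For `p = δ` and `m ≥ 0` this is the generation `G(δ)_m`, for which no location function is
needed. -/
def cubesAt {d : ℕ} (n : ℕ) (p : EuclideanSpace ℝ (Fin d)) (m : ℤ) : Set (Cube d) :=
  {Q | Q.side = 1 / (n : ℝ) ^ m ∧
    ∃ k : Fin d → ℤ, ∀ s, Q.corner s = p s + (k s : ℝ) / (n : ℝ) ^ m}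

/-- The `m`-th generation of `G(δ, L_a)`: the corners are `δ + k / nᵐ` if `m ≥ 0`, and
`δ + L_a(-m) + k / nᵐ` if `m < 0`. -/
def generation {d n : ℕ} (δ : EuclideanSpace ℝ (Fin d)) (a : ℕ → Fin d → Fin n) (m : ℤ) :
    Set (Cube d) :=
  if 0 ≤ m then cubesAt n δ m
  else cubesAt n (WithLp.toLp 2 fun s => δ s + (location a (-m).toNat s : ℝ)) m

/-- The `n`-adic grid `G(δ, L_a)`: all cubes of all generations. -/
def grid {d n : ℕ} (δ : EuclideanSpace ℝ (Fin d)) (a : ℕ → Fin d → Fin n) : Set (Cube d) :=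
  ⋃ m : ℤ, generation δ a m

/-- The union of the boundaries of the cubes of a collection. -/
def boundary {d : ℕ} (F : Set (Cube d)) : Set (EuclideanSpace ℝ (Fin d)) :=
  ⋃ Q ∈ F, frontier Q.toSet

/-- The distance `inf {‖x - y‖ : x ∈ A, y ∈ B}` of two (nonempty) sets. -/
def setDist {d : ℕ} (A B : Set (EuclideanSpace ℝ (Fin d))) : ℝ :=
  sInf {r | ∃ x ∈ A, ∃ y ∈ B, r = ‖x - y‖}

/-- The distance from `x` to `A` along the coordinate direction `e_k`, for sets `A` that meet the
line through `x` in this direction. -/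
def dirDist {d : ℕ} (k : Fin d) (A : Set (EuclideanSpace ℝ (Fin d)))
    (x : EuclideanSpace ℝ (Fin d)) : ℝ :=
  sInf {r | ∃ t : ℝ, x + t • EuclideanSpace.single k (1 : ℝ) ∈ A ∧ r = |t|}

/-- The natural deviation between `x` and `A`: the maximum of the distances along the coordinate
directions. -/
def dev {d : ℕ} (A : Set (EuclideanSpace ℝ (Fin d))) (x : EuclideanSpace ℝ (Fin d)) : ℝ :=
  ⨆ k : Fin d, dirDist k A x

/-- Vectors are separated if, in every coordinate, no two of them are congruent modulo `1`. -/
def Separated {d l : ℕ} (δ : Fin l → EuclideanSpace ℝ (Fin d)) : Prop :=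
  ∀ k : Fin d, ∀ i j : Fin l, i ≠ j → ∀ z : ℤ, δ i k - δ j k ≠ (z : ℝ)

/-- The small scale lattice of `δ₁, …, δ_d` at level `m ≥ 0`. -/
def smallScaleLattice {d : ℕ} (n : ℕ) (δ : Fin d → EuclideanSpace ℝ (Fin d)) (m : ℕ) :
    Set (EuclideanSpace ℝ (Fin d)) :=
  ⋂ k : Fin d, boundary (cubesAt n (δ k) (m : ℤ))

/-- `v` is an `n`-far vector with respect to the small scale lattice of the separated vectors
`δ₁, …, δ_d`. -/
def IsFarVector {d : ℕ} (n : ℕ) (v : EuclideanSpace ℝ (Fin d))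
    (δ : Fin d → EuclideanSpace ℝ (Fin d)) : Prop :=
  Separated δ ∧ ∃ C : ℝ, 0 < C ∧ ∀ m : ℕ,
    C / (n : ℝ) ^ m ≤ setDist (boundary (cubesAt n v (m : ℤ))) (smallScaleLattice n δ m)

/-- The cube `[0, nʲ)ᵈ`. -/
def originBox (d n j : ℕ) : Set (EuclideanSpace ℝ (Fin d)) :=
  {x | ∀ s, 0 ≤ x s ∧ x s < (n : ℝ) ^ j}

/-- The large scale sampling of `(δ₁, a₁), …, (δ_d, a_d)` at level `j`. -/
def largeScaleSampling {d n : ℕ} (δ : Fin d → EuclideanSpace ℝ (Fin d))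
    (a : Fin d → ℕ → Fin d → Fin n) (j : ℕ) : Set (EuclideanSpace ℝ (Fin d)) :=
  (⋂ k : Fin d, boundary (generation (δ k) (a k) (-(j : ℤ)))) ∩ originBox d n j

/-- The `j`-th modulated corner set of `(δ, a)`. -/
def modulatedCorner {d n : ℕ} (δ : EuclideanSpace ℝ (Fin d)) (a : ℕ → Fin d → Fin n) (j : ℕ) :
    Set (EuclideanSpace ℝ (Fin d)) :=
  boundary (generation δ a (-(j : ℤ))) ∩ originBox d n j

/-- The large scale sampling at level `j` of the tuples that remain when the `i`-th one is
removed. -/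
def samplingWithout {d n : ℕ} (δ : Fin (d + 1) → EuclideanSpace ℝ (Fin d))
    (a : Fin (d + 1) → ℕ → Fin d → Fin n) (i : Fin (d + 1)) (j : ℕ) :
    Set (EuclideanSpace ℝ (Fin d)) :=
  largeScaleSampling (fun k => δ (i.succAbove k)) (fun k => a (i.succAbove k)) j

/-- The distance between the `j`-th modulated corner set of the `i`-th grid and the large scale
sampling of the other grids, divided by `nʲ`. -/
def normalizedDist {d n : ℕ} (δ : Fin (d + 1) → EuclideanSpace ℝ (Fin d))
    (a : Fin (d + 1) → ℕ → Fin d → Fin n) (i : Fin (d + 1)) (j : ℕ) : ℝ :=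
  setDist (modulatedCorner (δ i) (a i) j) (samplingWithout δ a i j) / (n : ℝ) ^ j

/-- The largest natural deviation between the `j`-th modulated corner set of the `i`-th grid and
a point of the large scale sampling of the other grids, divided by `nʲ`. -/
def normalizedMaxDev {d n : ℕ} (δ : Fin (d + 1) → EuclideanSpace ℝ (Fin d))
    (a : Fin (d + 1) → ℕ → Fin d → Fin n) (i : Fin (d + 1)) (j : ℕ) : ℝ :=
  sSup (dev (modulatedCorner (δ i) (a i) j) '' samplingWithout δ a i j) / (n : ℝ) ^ j

end NAdic

end

namespace NAdic

variable {d n : ℕ}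

/-! Both sides of the equivalence say the same thing: there is one ε > 0 for which `Gap δ a ε m`
holds at every generation m.

If the gap holds, a cube with side below ε / nᵐ cannot be cut by generation m of all d + 1 grids:
two of the cuts would share one of the d coordinates and be too close. So some cell contains it
(`adjacent_of_gap`). Conversely, if planes of two grids nearly meet in coordinate s, the remaining
grids can be matched with the remaining coordinates. A tiny cube near the resulting point is cut by
every grid at generation m and, by nesting (`planes_mono`), at every finer one, so only
disproportionately large cells can contain it (`gap_of_adjacent`).

For m ≥ 0 the gap is the far condition, because the same matching reduces distances to the lattice
to one coordinate. For m = -j each grid has, per coordinate, exactly one plane in [0, nʲ), repeated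
with period nʲ. A gap modulo nʲ between two such planes means ε nʲ ≤ |x - y| ≤ (1 - ε) nʲ: the
liminf condition supplies the lower bound and the limsup condition the upper one. Asymptotic
conditions suffice, since the finitely many remaining levels inherit a gap from level 0 by nesting.
-/

/-- The real numbers `c + k / nᵐ`, `k ∈ ℤ`. -/
def translates (n : ℕ) (c : ℝ) (m : ℤ) : Set ℝ := {t | ∃ k : ℤ, t = c + (k : ℝ) / (n : ℝ) ^ m}

/-- The positions, in the coordinate `s`, of the hyperplanes that bound the cubes of the `m`-th
generation of a grid. -/
def planes (δ : EuclideanSpace ℝ (Fin d)) (a : ℕ → Fin d → Fin n) (m : ℤ) (s : Fin d) : Set ℝ :=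
  translates n (δ s + (location a (-m).toNat s : ℝ)) m

/-! ### Boundaries of generations as unions of hyperplanes -/

theorem frontier_toSet_subset (Q : Cube d) :
    frontier Q.toSet ⊆ {x | ∃ s, x s = Q.corner s ∨ x s = Q.corner s + Q.side} := by
  intro x hx
  have hcl : closure Q.toSet ⊆ {x | ∀ s, Q.corner s ≤ x s ∧ x s ≤ Q.corner s + Q.side} := by
    apply closure_minimal
    · intro y hy s
      exact ⟨(hy s).1, (hy s).2.le⟩
    · simp only [Set.ofPred_forall, Set.ofPred_and]
      refine isClosed_iInter fun s => IsClosed.inter ?_ ?_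
      · exact isClosed_le (by fun_prop) (by fun_prop)
      · exact isClosed_le (by fun_prop) (by fun_prop)
  have hint : {x : EuclideanSpace ℝ (Fin d) |
      ∀ s, Q.corner s < x s ∧ x s < Q.corner s + Q.side} ⊆ interior Q.toSet := by
    apply interior_maximal
    · intro y hy s
      exact ⟨(hy s).1.le, (hy s).2⟩
    · simp only [Set.ofPred_forall, Set.ofPred_and]
      refine isOpen_iInter_of_finite fun s => IsOpen.inter ?_ ?_
      · exact isOpen_lt (by fun_prop) (by fun_prop)
      · exact isOpen_lt (by fun_prop) (by fun_prop)
  by_contra hne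
  refine hx.2 (hint fun s => ?_)
  have h1 := hcl hx.1 s
  simp only [Set.mem_ofPred_eq, not_exists, not_or] at hne
  exact ⟨lt_of_le_of_ne h1.1 (Ne.symm (hne s).1), lt_of_le_of_ne h1.2 (hne s).2⟩

theorem mem_frontier_of_eq_corner {Q : Cube d} {x : EuclideanSpace ℝ (Fin d)} (hx : x ∈ Q.toSet)
    {s : Fin d} (hs : x s = Q.corner s) : x ∈ frontier Q.toSet := by
  refine ⟨subset_closure hx, fun hi => ?_⟩
  obtain ⟨r, hr, hball⟩ := Metric.mem_nhds_iff.1 (mem_interior_iff_mem_nhds.1 hi)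
  -- Moving down by r / 2 in coordinate s stays in the ball but leaves the cube.
  have hmem : x - EuclideanSpace.single s (r / 2) ∈ Metric.ball x r := by
    rw [Metric.mem_ball, dist_eq_norm, sub_sub_cancel_left, norm_neg, PiLp.norm_single,
      Real.norm_of_nonneg (by positivity)]
    linarith
  have h := (hball hmem s).1
  simp at h
  linarith

theorem pow_pos_of_two_le (hn : 2 ≤ n) (m : ℤ) : (0 : ℝ) < (n : ℝ) ^ m :=
  zpow_pos (by exact_mod_cast (by omega : 0 < n)) m

theorem exists_mem_translates (hn : 2 ≤ n) (c : ℝ) (m : ℤ) (x : ℝ) :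
    ∃ k : ℤ, c + (k : ℝ) / (n : ℝ) ^ m ≤ x ∧ x < c + (k : ℝ) / (n : ℝ) ^ m + 1 / (n : ℝ) ^ m := by
  have h := pow_pos_of_two_le hn m
  refine ⟨⌊(x - c) * (n : ℝ) ^ m⌋, ?_, ?_⟩
  · have := Int.floor_le ((x - c) * (n : ℝ) ^ m)
    rw [← le_sub_iff_add_le', div_le_iff₀ h]
    exact this
  · have := Int.lt_floor_add_one ((x - c) * (n : ℝ) ^ m)
    rw [add_assoc, ← add_div, ← sub_lt_iff_lt_add', lt_div_iff₀ h]
    exact this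

theorem mem_boundary_cubesAt (hn : 2 ≤ n) (p x : EuclideanSpace ℝ (Fin d)) (m : ℤ) :
    x ∈ boundary (cubesAt n p m) ↔ ∃ s, x s ∈ translates n (p s) m := by
  have h := pow_pos_of_two_le hn m
  simp only [boundary, Set.mem_iUnion]
  constructor
  · rintro ⟨Q, ⟨hside, k, hk⟩, hx⟩
    obtain ⟨s, hs | hs⟩ := frontier_toSet_subset Q hx
    · exact ⟨s, k s, by rw [hs, hk]⟩
    · refine ⟨s, k s + 1, ?_⟩
      rw [hs, hk, hside]
      push_cast
      ring
  · rintro ⟨s, k, hk⟩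
    -- The half-open cell containing x works: a translate in [corner, corner + side) can only be the
    -- corner coordinate itself.
    choose c hc using fun t => exists_mem_translates hn (p t) m (x t)
    refine ⟨⟨WithLp.toLp 2 fun t => p t + (c t : ℝ) / (n : ℝ) ^ m, 1 / (n : ℝ) ^ m, by positivity⟩,
      ⟨rfl, c, fun t => rfl⟩, mem_frontier_of_eq_corner (s := s) hc ?_⟩
    have h1 := (hc s).1
    have h2 := (hc s).2
    rw [hk] at h1 h2
    rw [add_le_add_iff_left, div_le_div_iff_of_pos_right h] at h1
    rw [add_assoc, add_lt_add_iff_left, ← add_div, div_lt_div_iff_of_pos_right h] at h2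
    have : k = c s := by
      have h1' : c s ≤ k := by exact_mod_cast h1
      have h2' : k < c s + 1 := by exact_mod_cast h2
      omega
    change x s = p s + _
    rw [hk, this]

/-- For m ≥ 0 the truncation `(-m).toNat` is 0, where the location function vanishes, so one formula
covers all generations. -/
theorem generation_eq (δ : EuclideanSpace ℝ (Fin d)) (a : ℕ → Fin d → Fin n) (m : ℤ) :
    generation δ a m =
      cubesAt n (WithLp.toLp 2 fun s => δ s + (location a (-m).toNat s : ℝ)) m := by
  unfold generation
  split_ifs with h
  · have : (-m).toNat = 0 := by omega
    simp [this, location]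
  · rfl

theorem mem_boundary_generation (hn : 2 ≤ n) (δ x : EuclideanSpace ℝ (Fin d))
    (a : ℕ → Fin d → Fin n) (m : ℤ) :
    x ∈ boundary (generation δ a m) ↔ ∃ s, x s ∈ planes δ a m s := by
  rw [generation_eq, mem_boundary_cubesAt hn]
  rfl

theorem planes_natCast (δ : EuclideanSpace ℝ (Fin d)) (a : ℕ → Fin d → Fin n) (m : ℕ)
    (s : Fin d) : planes δ a m s = translates n (δ s) m := by
  simp [planes, location]

/-- Nesting of generations. In the large scales it rests on the new summand of the location
function, nʲ aⱼ, being a multiple of the finer sidelength nʲ. -/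
theorem planes_subset_succ (hn : 2 ≤ n) (δ : EuclideanSpace ℝ (Fin d)) (a : ℕ → Fin d → Fin n)
    (m : ℤ) (s : Fin d) : planes δ a m s ⊆ planes δ a (m + 1) s := by
  have hn0 : (n : ℝ) ≠ 0 := by
    have : n ≠ 0 := by omega
    exact_mod_cast this
  rintro t ⟨k, rfl⟩
  rcases lt_or_ge m 0 with hm | hm
  · obtain ⟨j, rfl⟩ : ∃ j : ℕ, m = -((j : ℤ) + 1) := ⟨(-m - 1).toNat, by omega⟩
    have h1 : (-(-((j : ℤ) + 1))).toNat = j + 1 := by omega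
    have h2 : (-(-((j : ℤ) + 1) + 1)).toNat = j := by omega
    refine ⟨(a j s : ℕ) + k * n, ?_⟩
    rw [h1, h2, location, Finset.sum_range_succ, ← location]
    have h3 : (-((j : ℤ) + 1) + 1) = -(j : ℤ) := by ring
    have h4 : (-((j : ℤ) + 1)) = -((j + 1 : ℕ) : ℤ) := by push_cast; ring
    rw [h3, h4, zpow_neg, zpow_neg, zpow_natCast, zpow_natCast]
    push_cast
    field_simp
    ring
  · have h1 : (-m).toNat = 0 := by omega
    have h2 : (-(m + 1)).toNat = 0 := by omega
    refine ⟨k * n, ?_⟩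
    rw [h1, h2, zpow_add_one₀ hn0]
    push_cast
    field_simp

theorem planes_mono (hn : 2 ≤ n) (δ : EuclideanSpace ℝ (Fin d)) (a : ℕ → Fin d → Fin n)
    (s : Fin d) : Monotone fun m => planes δ a m s :=
  monotone_int_of_le_succ fun m => planes_subset_succ hn δ a m s

theorem exists_mem_planes (δ : EuclideanSpace ℝ (Fin d)) (a : ℕ → Fin d → Fin n)
    (m : ℤ) (s : Fin d) : ∃ q, q ∈ planes δ a m s := ⟨_, 0, rfl⟩

theorem exists_mem_planes_box (hn : 2 ≤ n) (δ : EuclideanSpace ℝ (Fin d)) (a : ℕ → Fin d → Fin n)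
    (j : ℕ) (s : Fin d) : ∃ q ∈ planes δ a (-j) s, 0 ≤ q ∧ q < (n : ℝ) ^ j := by
  obtain ⟨k, h1, h2⟩ := exists_mem_translates hn
    (δ s + (location a (-(-(j : ℤ))).toNat s : ℝ)) (-j) 0
  have hL : 1 / (n : ℝ) ^ (-(j : ℤ)) = (n : ℝ) ^ j := by simp
  rw [hL] at h2
  -- The last plane at or below 0 is either 0 itself, or the next plane lies in the box.
  rcases h1.eq_or_lt with h | h
  · exact ⟨_, ⟨k, rfl⟩, h.ge, by rw [h]; exact pow_pos (by exact_mod_cast (by omega : 0 < n)) j⟩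
  · refine ⟨_, ⟨k + 1, rfl⟩, ?_, ?_⟩ <;> push_cast <;> rw [add_div, ← add_assoc, hL] <;> linarith

/-! ### Gaps, and matchings of grids with coordinates -/

/-- In each coordinate, the `m`-th generations of any two of the grids have their hyperplanes at
distance at least `ε / nᵐ`. -/
def Gap {ι : Type*} (δ : ι → EuclideanSpace ℝ (Fin d)) (a : ι → ℕ → Fin d → Fin n) (ε : ℝ)
    (m : ℤ) : Prop :=
  ∀ s i k, i ≠ k → ∀ x ∈ planes (δ i) (a i) m s, ∀ y ∈ planes (δ k) (a k) m s,
    ε / (n : ℝ) ^ m ≤ |x - y|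

theorem Gap.not_mem {ι : Type*} {δ : ι → EuclideanSpace ℝ (Fin d)} {a : ι → ℕ → Fin d → Fin n}
    {ε : ℝ} {m : ℤ} (hn : 2 ≤ n) (hε : 0 < ε) (h : Gap δ a ε m) {i k : ι} {s : Fin d} {x : ℝ}
    (hi : x ∈ planes (δ i) (a i) m s) (hk : x ∈ planes (δ k) (a k) m s) : i = k := by
  by_contra hne
  have := h s i k hne x hi x hk
  have h1 := div_pos hε (pow_pos_of_two_le hn m)
  simp at this
  linarith

/-- One can assign the coordinates to `d` families of sets bijectively, one pair being
prescribed. -/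
theorem exists_transversal {B : Fin d → Fin d → Set ℝ} (hB : ∀ k t, (B k t).Nonempty)
    (k₀ s : Fin d) {y₀ : ℝ} (hy₀ : y₀ ∈ B k₀ s) :
    ∃ y : EuclideanSpace ℝ (Fin d), y s = y₀ ∧ (∀ k, ∃ t, y t ∈ B k t) ∧ ∀ t, ∃ k, y t ∈ B k t := by
  choose b hb using hB
  -- The matching is the transposition of k₀ and s; being its own inverse, it also tells which
  -- coordinate serves a given family.
  have key : ∀ t, Function.update (fun t => b (Equiv.swap k₀ s t) t) s y₀ t ∈
      B (Equiv.swap k₀ s t) t := by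
    intro t
    rcases eq_or_ne t s with rfl | h
    · simpa using hy₀
    · simpa [h] using hb _ t
  refine ⟨WithLp.toLp 2 (Function.update (fun t => b (Equiv.swap k₀ s t) t) s y₀), by simp,
    fun k => ⟨Equiv.swap k₀ s k, ?_⟩, fun t => ⟨_, key t⟩⟩
  simpa using key (Equiv.swap k₀ s k)

/-- By disjointness, distinct families use distinct coordinates. With d of each, the injection is
onto, so every coordinate is used. -/
theorem exists_of_disjoint_of_transversal {B : Fin d → Fin d → Set ℝ}
    (hB : ∀ t k l x, x ∈ B k t → x ∈ B l t → k = l) {y : Fin d → ℝ}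
    (hy : ∀ k, ∃ t, y t ∈ B k t) (t : Fin d) : ∃ k, y t ∈ B k t := by
  choose f hf using hy
  have hinj : Function.Injective f := fun k l hkl => hB (f k) k l (y (f k)) (hf k) (by
    rw [hkl]; exact hf l)
  obtain ⟨k, rfl⟩ := Finite.surjective_of_injective hinj t
  exact ⟨k, hf k⟩

/-! ### Adjacency as a uniform gap -/

theorem exists_subset_of_disjoint_planes (hn : 2 ≤ n) (δ : EuclideanSpace ℝ (Fin d))
    (a : ℕ → Fin d → Fin n) (m : ℤ) (Q : Cube d)
    (h : ∀ s, ∀ x ∈ planes δ a m s, ¬(Q.corner s < x ∧ x < Q.corner s + Q.side)) :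
    ∃ R ∈ generation δ a m, Q.toSet ⊆ R.toSet ∧ R.side = 1 / (n : ℝ) ^ m := by
  have hp := pow_pos_of_two_le hn m
  choose c hc using fun s => exists_mem_translates hn (δ s + (location a (-m).toNat s : ℝ)) m
    (Q.corner s)
  refine ⟨⟨WithLp.toLp 2 fun s => δ s + (location a (-m).toNat s : ℝ) + (c s : ℝ) / (n : ℝ) ^ m,
    1 / (n : ℝ) ^ m, by positivity⟩, ?_, ?_, rfl⟩
  · rw [generation_eq]
    exact ⟨rfl, c, fun s => rfl⟩
  · intro x hx s
    refine ⟨(hc s).1.trans (hx s).1, (hx s).2.trans_le ?_⟩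
    have := h s _ ⟨c s + 1, rfl⟩
    push_cast at this
    rw [add_div, ← add_assoc] at this
    by_contra hlt
    exact this ⟨(hc s).2, not_le.1 hlt⟩

/-- A plane inside Q would be strictly inside R in coordinate s, which forces an integer strictly
between two consecutive ones. -/
theorem not_mem_planes_of_subset (hn : 2 ≤ n) (δ : EuclideanSpace ℝ (Fin d))
    (a : ℕ → Fin d → Fin n) (m : ℤ) {Q R : Cube d} (hR : R ∈ generation δ a m)
    (hQR : Q.toSet ⊆ R.toSet) {s : Fin d} {x : ℝ} (hx : x ∈ planes δ a m s)
    (h1 : Q.corner s < x) : Q.corner s + Q.side ≤ x := by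
  have hp := pow_pos_of_two_le hn m
  have hQ := Q.side_pos
  by_contra! h2
  rw [generation_eq] at hR
  obtain ⟨hside, c, hc⟩ := hR
  obtain ⟨k, hk⟩ := hx
  have hcorner : Q.corner ∈ Q.toSet := fun t => ⟨le_rfl, by linarith⟩
  have hlow := (hQR hcorner s).1
  have hmem : WithLp.toLp 2 (Function.update Q.corner s x) ∈ Q.toSet := by
    intro t
    rcases eq_or_ne t s with rfl | h
    · simpa using ⟨h1.le, h2⟩
    · simpa [h] using hQ
  have hup := (hQR hmem s).2
  simp only [Function.update_self] at hup
  have e1 : (c s : ℝ) / (n : ℝ) ^ m < k / (n : ℝ) ^ m := by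
    have := hc s
    simp only at this
    linarith
  have e2 : (k : ℝ) / (n : ℝ) ^ m < (c s + 1) / (n : ℝ) ^ m := by
    have := hc s
    simp only at this
    rw [add_div, ← hside]
    linarith
  rw [div_lt_div_iff_of_pos_right hp] at e1 e2
  have e1' : c s < k := by exact_mod_cast e1
  have e2' : k < c s + 1 := by exact_mod_cast e2
  omega

variable {δ : Fin (d + 1) → EuclideanSpace ℝ (Fin d)} {a : Fin (d + 1) → ℕ → Fin d → Fin n}

theorem adjacent_of_gap (hn : 2 ≤ n) {ε : ℝ} (hε : 0 < ε) (h : ∀ m, Gap δ a ε m) :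
    Adjacent fun i => grid (δ i) (a i) := by
  have hn1 : (1 : ℝ) < n := by exact_mod_cast hn
  refine ⟨n / ε, fun Q => ?_⟩
  -- With nᴹ ≤ ℓ(Q)/ε < nᴹ⁺¹, cells of side nᴹ⁺¹ have gaps wider than Q, yet are at most (n/ε) ℓ(Q)
  -- long.
  obtain ⟨M, hM1, hM2⟩ := exists_mem_Ico_zpow (div_pos Q.side_pos hε) hn1
  have hside : Q.side < ε / (n : ℝ) ^ (-(M + 1)) := by
    rw [zpow_neg, div_inv_eq_mul, mul_comm]
    exact (div_lt_iff₀ hε).1 hM2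
  have hex : ∃ i, ∀ s, ∀ x ∈ planes (δ i) (a i) (-(M + 1)) s,
      ¬(Q.corner s < x ∧ x < Q.corner s + Q.side) := by
    by_contra! hcon
    choose s x hx hx1 hx2 using hcon
    obtain ⟨i, k, hik, hs⟩ := Fintype.exists_ne_map_eq_of_card_lt s (by simp)
    have hgap := h _ (s i) i k hik (x i) (hx i) (x k) (by rw [hs]; exact hx k)
    have b1 := hx1 i
    have b2 := hx2 i
    rw [hs] at b1 b2
    have : |x i - x k| < Q.side := by
      rw [abs_lt]
      constructor <;> linarith [hx1 k, hx2 k]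
    linarith
  obtain ⟨i, hi⟩ := hex
  obtain ⟨R, hR, hQR, hRside⟩ := exists_subset_of_disjoint_planes hn (δ i) (a i) _ Q hi
  refine ⟨i, R, Set.mem_iUnion.2 ⟨_, hR⟩, hQR, ?_⟩
  rw [hRside, zpow_neg, one_div, inv_inv, zpow_add_one₀ (by linarith), div_mul_eq_mul_div,
    mul_div_assoc, mul_comm]
  gcongr

theorem gap_of_adjacent (hn : 2 ≤ n) (h : Adjacent fun i => grid (δ i) (a i)) :
    ∃ ε : ℝ, 0 < ε ∧ ∀ m, Gap δ a ε m := by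
  have hn1 : (1 : ℝ) < n := by exact_mod_cast hn
  obtain ⟨C, hC⟩ := h
  have hC0 : 0 < |C| + 1 := by positivity
  -- The sign of C is unknown; |C| + 1 is positive and exceeds C.
  refine ⟨1 / (|C| + 1), by positivity, fun m s i k hik x hx y hy => ?_⟩
  have hp := pow_pos_of_two_le hn m
  by_contra! hlt
  set l := 1 / (|C| + 1) / (n : ℝ) ^ m with hl
  have hl0 : 0 < l := by positivity
  obtain ⟨k', rfl⟩ := Fin.exists_succAbove_eq hik.symm
  obtain ⟨z, hzs, hz, -⟩ := exists_transversal
    (B := fun k t => planes (δ (i.succAbove k)) (a (i.succAbove k)) m t)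
    (fun k t => exists_mem_planes _ _ m t) k' s hy
  rw [abs_lt] at hlt
  -- Q is centred at the matched point z, except that in coordinate s it is centred at the midpoint
  -- of x and y, so that both cut it.
  let Q : Cube d :=
    ⟨WithLp.toLp 2 (Function.update (fun t => z t - l / 2) s ((x + y) / 2 - l / 2)), l, hl0⟩
  have hQs : Q.corner s = (x + y) / 2 - l / 2 := by simp [Q]
  have hmid : ∀ t, Q.corner t < z t ∧ z t < Q.corner t + l := by
    intro t
    rcases eq_or_ne t s with rfl | ht
    · rw [hQs, hzs]
      constructor <;> linarith
    · have : Q.corner t = z t - l / 2 := by simp [Q, ht]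
      rw [this]
      constructor <;> linarith
  have hhit : ∀ i', ∃ t, ∃ v ∈ planes (δ i') (a i') m t, Q.corner t < v ∧ v < Q.corner t + l := by
    intro i'
    rcases eq_or_ne i' i with rfl | hi'
    · exact ⟨s, x, hx, by rw [hQs]; linarith, by rw [hQs]; linarith⟩
    · obtain ⟨k, rfl⟩ := Fin.exists_succAbove_eq hi'
      obtain ⟨t, ht⟩ := hz k
      exact ⟨t, z t, ht, hmid t⟩
  obtain ⟨i', R, hR, hQR, hside⟩ := hC Q
  obtain ⟨m', hm'⟩ := Set.mem_iUnion.1 hR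
  -- Since C l ≤ 1 / nᵐ, the cell R is no coarser than generation m, and its own grid already cuts Q
  -- there.
  have hle : m ≤ m' := by
    have h1 : R.side = 1 / (n : ℝ) ^ m' := by
      rw [generation_eq] at hm'
      exact hm'.1
    have hp' := pow_pos_of_two_le hn m'
    have h2 : C * l ≤ 1 / (n : ℝ) ^ m := by
      rw [hl, ← mul_div_assoc]
      gcongr
      rw [mul_one_div, div_le_one hC0]
      linarith [le_abs_self C]
    have h3 := (h1.symm.le.trans hside).trans h2
    rwa [one_div_le_one_div hp' hp, zpow_le_zpow_iff_right₀ hn1] at h3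
  obtain ⟨t, v, hv, hv1, hv2⟩ := hhit i'
  have := not_mem_planes_of_subset hn _ _ m' hm' hQR (planes_mono hn _ _ t hle hv) hv1
  exact absurd hv2 (not_lt.2 this)

/-! ### Distances, and the small scales -/

theorem setDist_le {A B : Set (EuclideanSpace ℝ (Fin d))} {x y : EuclideanSpace ℝ (Fin d)}
    (hx : x ∈ A) (hy : y ∈ B) : setDist A B ≤ ‖x - y‖ :=
  csInf_le ⟨0, by rintro _ ⟨x, -, y, -, rfl⟩; positivity⟩ ⟨x, hx, y, hy, rfl⟩

theorem le_setDist {A B : Set (EuclideanSpace ℝ (Fin d))} (hA : A.Nonempty) (hB : B.Nonempty)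
    {r : ℝ} (h : ∀ x ∈ A, ∀ y ∈ B, r ≤ ‖x - y‖) : r ≤ setDist A B := by
  obtain ⟨x, hx⟩ := hA
  obtain ⟨y, hy⟩ := hB
  refine le_csInf ⟨_, x, hx, y, hy, rfl⟩ ?_
  rintro _ ⟨x, hx, y, hy, rfl⟩
  exact h x hx y hy

theorem setDist_nonneg (A B : Set (EuclideanSpace ℝ (Fin d))) : 0 ≤ setDist A B :=
  Real.sInf_nonneg (by rintro _ ⟨x, -, y, -, rfl⟩; positivity)

theorem abs_sub_le_norm (x y : EuclideanSpace ℝ (Fin d)) (s : Fin d) : |x s - y s| ≤ ‖x - y‖ := by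
  simpa using PiLp.norm_apply_le (x - y) s

/-- The point obtained from `y` by changing the coordinate `s` to `c`. -/
noncomputable def setCoord (y : EuclideanSpace ℝ (Fin d)) (s : Fin d) (c : ℝ) : EuclideanSpace ℝ (Fin d) :=
  y + (c - y s) • EuclideanSpace.single s (1 : ℝ)

@[simp] theorem setCoord_self (y : EuclideanSpace ℝ (Fin d)) (s : Fin d) (c : ℝ) :
    setCoord y s c s = c := by
  simp [setCoord]

theorem setCoord_of_ne (y : EuclideanSpace ℝ (Fin d)) {s t : Fin d} (h : t ≠ s) (c : ℝ) :
    setCoord y s c t = y t := by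
  simp [setCoord, h]

theorem norm_setCoord_sub (y : EuclideanSpace ℝ (Fin d)) (s : Fin d) (c : ℝ) :
    ‖setCoord y s c - y‖ = |c - y s| := by
  simp [setCoord, norm_smul]

theorem mem_smallScaleLattice (hn : 2 ≤ n) (δ : Fin d → EuclideanSpace ℝ (Fin d))
    (a : Fin d → ℕ → Fin d → Fin n) (m : ℕ) (y : EuclideanSpace ℝ (Fin d)) :
    y ∈ smallScaleLattice n δ m ↔ ∀ k, ∃ t, y t ∈ planes (δ k) (a k) m t := by
  simp [smallScaleLattice, mem_boundary_cubesAt hn, planes_natCast]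

theorem Gap.separated {ι : Type*} {δ : ι → EuclideanSpace ℝ (Fin d)} {a : ι → ℕ → Fin d → Fin n}
    {ε : ℝ} (hn : 2 ≤ n) (hε : 0 < ε) (h : Gap δ a ε 0) {i k : ι} (hik : i ≠ k) (s : Fin d)
    (z : ℤ) : δ i s - δ k s ≠ z := by
  intro hz
  refine hik (h.not_mem hn hε (s := s) (x := δ i s) ⟨0, ?_⟩ ⟨z, ?_⟩)
  · simp [location]
  · simp [location, ← hz]

/-- A boundary point has some coordinate s on a plane of grid i, while every coordinate of a lattice
point is on a plane of another grid. Comparing in coordinate s bounds the norm. -/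
theorem isFarVector_of_gap (hd : 1 ≤ d) (hn : 2 ≤ n) {ε : ℝ} (hε : 0 < ε)
    (h : ∀ m : ℕ, Gap δ a ε m) (i : Fin (d + 1)) :
    IsFarVector n (δ i) fun k => δ (i.succAbove k) := by
  have h0 : Gap δ a ε 0 := h 0
  refine ⟨fun s k l hkl z => h0.separated hn hε (by simpa using hkl) s z, ε, hε, fun m => ?_⟩
  have hmem := mem_smallScaleLattice hn (fun k => δ (i.succAbove k))
    (fun k => a (i.succAbove k)) m
  have hmem' : ∀ x, x ∈ boundary (cubesAt n (δ i) m) ↔ ∃ s, x s ∈ planes (δ i) (a i) m s := by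
    intro x
    simp [mem_boundary_cubesAt hn, planes_natCast]
  refine le_setDist ?_ ?_ fun x hx y hy => ?_
  · obtain ⟨c, hc⟩ := exists_mem_planes (δ i) (a i) m ⟨0, hd⟩
    exact ⟨setCoord 0 ⟨0, hd⟩ c, (hmem' _).2 ⟨⟨0, hd⟩, by simpa using hc⟩⟩
  · obtain ⟨c, hc⟩ := exists_mem_planes (δ (i.succAbove ⟨0, hd⟩)) (a (i.succAbove ⟨0, hd⟩)) m ⟨0, hd⟩
    obtain ⟨y, -, hy, -⟩ := exists_transversal
      (B := fun k t => planes (δ (i.succAbove k)) (a (i.succAbove k)) m t)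
      (fun k t => exists_mem_planes _ _ m t) _ _ hc
    exact ⟨y, (hmem y).2 hy⟩
  · obtain ⟨s, hs⟩ := (hmem' x).1 hx
    obtain ⟨k, hk⟩ := exists_of_disjoint_of_transversal
      (B := fun k t => planes (δ (i.succAbove k)) (a (i.succAbove k)) m t)
      (fun t k l u hk hl => by simpa using (h m).not_mem hn hε hk hl) ((hmem y).1 hy) s
    exact (h m s i (i.succAbove k) (Fin.succAbove_ne i k).symm _ hs _ hk).trans
      (abs_sub_le_norm x y s)

/-- Extend the plane position y to a lattice point z and change its coordinate s to x: the result is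
a boundary point at distance exactly |x - y|. The smallest of the d + 1 constants serves all pairs.
-/
theorem gap_of_isFarVector (hn : 2 ≤ n)
    (h : ∀ i, IsFarVector n (δ i) fun k => δ (i.succAbove k)) :
    ∃ ε : ℝ, 0 < ε ∧ ∀ m : ℕ, Gap δ a ε m := by
  choose hsep C hC hdist using h
  refine ⟨Finset.univ.inf' Finset.univ_nonempty C,
    (Finset.lt_inf'_iff _).2 fun i _ => hC i, fun m s i k hik x hx y hy => ?_⟩
  have hp := pow_pos_of_two_le hn m
  obtain ⟨k', rfl⟩ := Fin.exists_succAbove_eq hik.symm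
  obtain ⟨z, hzs, hz, -⟩ := exists_transversal
    (B := fun k t => planes (δ (i.succAbove k)) (a (i.succAbove k)) m t)
    (fun k t => exists_mem_planes _ _ m t) k' s hy
  have hz' := (mem_smallScaleLattice hn (fun k => δ (i.succAbove k))
    (fun k => a (i.succAbove k)) m z).2 hz
  have hx' : setCoord z s x ∈ boundary (cubesAt n (δ i) m) := by
    rw [mem_boundary_cubesAt hn]
    exact ⟨s, by simpa [planes_natCast] using hx⟩
  calc _ ≤ C i / (n : ℝ) ^ (m : ℤ) := by
        gcongr
        exact Finset.inf'_le _ (Finset.mem_univ i)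
    _ ≤ _ := by simpa using hdist i m
    _ ≤ _ := setDist_le hx' hz'
    _ = _ := by rw [norm_setCoord_sub, hzs]

/-! ### The large scales: planes modulo nʲ -/

theorem exists_sub_eq_of_mem_planes {δ : EuclideanSpace ℝ (Fin d)} {a : ℕ → Fin d → Fin n} {j : ℕ}
    {s : Fin d} {x y : ℝ} (hx : x ∈ planes δ a (-j) s) (hy : y ∈ planes δ a (-j) s) :
    ∃ z : ℤ, x - y = z * (n : ℝ) ^ j := by
  obtain ⟨k, rfl⟩ := hx
  obtain ⟨l, rfl⟩ := hy
  refine ⟨k - l, ?_⟩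
  simp only [zpow_neg, zpow_natCast, div_inv_eq_mul]
  push_cast
  ring

theorem add_mem_planes {δ : EuclideanSpace ℝ (Fin d)} {a : ℕ → Fin d → Fin n} {j : ℕ}
    {s : Fin d} {x : ℝ} (hx : x ∈ planes δ a (-j) s) (z : ℤ) :
    x + z * (n : ℝ) ^ j ∈ planes δ a (-j) s := by
  obtain ⟨k, rfl⟩ := hx
  refine ⟨k + z, ?_⟩
  simp only [zpow_neg, zpow_natCast, div_inv_eq_mul]
  push_cast
  ring

theorem eq_of_mem_planes_box {δ : EuclideanSpace ℝ (Fin d)} {a : ℕ → Fin d → Fin n} {j : ℕ}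
    {s : Fin d} {x y : ℝ} (hx : x ∈ planes δ a (-j) s) (hy : y ∈ planes δ a (-j) s)
    (hx0 : 0 ≤ x) (hx1 : x < (n : ℝ) ^ j) (hy0 : 0 ≤ y) (hy1 : y < (n : ℝ) ^ j) : x = y := by
  obtain ⟨z, hz⟩ := exists_sub_eq_of_mem_planes hx hy
  have hpos : (0 : ℝ) < (n : ℝ) ^ j := hx0.trans_lt hx1
  have h1 : (z : ℝ) < 1 := by
    by_contra! h
    nlinarith
  have h2 : (-1 : ℝ) < z := by
    by_contra! h
    nlinarith
  have h1' : z < 1 := by exact_mod_cast h1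
  have h2' : -1 < z := by exact_mod_cast h2
  have : z = 0 := by omega
  rw [this] at hz
  simp at hz
  linarith

/-- At generation -j all shifts, by locations and by multiples of nʲ, are integers, so incongruence
modulo 1 is enough. -/
theorem planes_disjoint_of_sub_ne {δ δ' : EuclideanSpace ℝ (Fin d)} {a a' : ℕ → Fin d → Fin n}
    {j : ℕ} {s : Fin d} (h : ∀ z : ℤ, δ s - δ' s ≠ z) {x : ℝ}
    (hx : x ∈ planes δ a (-j) s) : x ∉ planes δ' a' (-j) s := by
  rintro ⟨l, hl⟩
  obtain ⟨k, hk⟩ := hx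
  rw [zpow_neg, zpow_natCast, div_inv_eq_mul] at hk hl
  apply h (location a' (- -(j : ℤ)).toNat s - location a (- -(j : ℤ)).toNat s + (l - k) * n ^ j)
  push_cast
  linarith

theorem mem_modulatedCorner (hn : 2 ≤ n) (δ x : EuclideanSpace ℝ (Fin d)) (a : ℕ → Fin d → Fin n)
    (j : ℕ) : x ∈ modulatedCorner δ a j ↔
      (∃ s, x s ∈ planes δ a (-j) s) ∧ ∀ s, 0 ≤ x s ∧ x s < (n : ℝ) ^ j := by
  rw [modulatedCorner, Set.mem_inter_iff, mem_boundary_generation hn]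
  rfl

theorem mem_samplingWithout (hn : 2 ≤ n) (i : Fin (d + 1)) (j : ℕ)
    (y : EuclideanSpace ℝ (Fin d)) : y ∈ samplingWithout δ a i j ↔
      (∀ k, ∃ t, y t ∈ planes (δ (i.succAbove k)) (a (i.succAbove k)) (-j) t) ∧
        ∀ s, 0 ≤ y s ∧ y s < (n : ℝ) ^ j := by
  rw [samplingWithout, largeScaleSampling, Set.mem_inter_iff, Set.mem_iInter]
  simp only [mem_boundary_generation hn]
  rfl

theorem setCoord_mem_modulatedCorner (hn : 2 ≤ n) {δ y : EuclideanSpace ℝ (Fin d)}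
    {a : ℕ → Fin d → Fin n} {j : ℕ} {s : Fin d} {q : ℝ} (hq : q ∈ planes δ a (-j) s)
    (hq0 : 0 ≤ q ∧ q < (n : ℝ) ^ j) (hy : ∀ s, 0 ≤ y s ∧ y s < (n : ℝ) ^ j) :
    setCoord y s q ∈ modulatedCorner δ a j := by
  refine (mem_modulatedCorner hn _ _ _ _).2 ⟨⟨s, by simpa using hq⟩, fun t => ?_⟩
  rcases eq_or_ne t s with rfl | h
  · simpa using hq0
  · simpa [setCoord_of_ne y h] using hy t

theorem dirDist_le_dev (k : Fin d) (A : Set (EuclideanSpace ℝ (Fin d)))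
    (x : EuclideanSpace ℝ (Fin d)) : dirDist k A x ≤ dev A x :=
  le_ciSup (f := fun k => dirDist k A x) (Set.finite_range _).bddAbove k

theorem dirDist_le_abs_sub {A : Set (EuclideanSpace ℝ (Fin d))} {y : EuclideanSpace ℝ (Fin d)}
    {k : Fin d} {c : ℝ} (h : setCoord y k c ∈ A) : dirDist k A y ≤ |c - y k| :=
  csInf_le ⟨0, by rintro _ ⟨t, -, rfl⟩; positivity⟩ ⟨c - y k, h, rfl⟩

theorem setDist_le_dirDist {A B : Set (EuclideanSpace ℝ (Fin d))} {y : EuclideanSpace ℝ (Fin d)}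
    {k : Fin d} {c : ℝ} (h : setCoord y k c ∈ A) (hy : y ∈ B) : setDist A B ≤ dirDist k A y := by
  refine le_csInf ⟨_, c - y k, h, rfl⟩ ?_
  rintro _ ⟨t, ht, rfl⟩
  simpa [norm_smul] using setDist_le ht hy

/-- The assumption `hne` means that a move along coordinate s can reach the corner set only through
that coordinate, where the box has a single plane. -/
theorem dirDist_modulatedCorner (hn : 2 ≤ n) {δ y : EuclideanSpace ℝ (Fin d)}
    {a : ℕ → Fin d → Fin n} {j : ℕ} {s : Fin d} {q : ℝ} (hq : q ∈ planes δ a (-j) s)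
    (hq0 : 0 ≤ q ∧ q < (n : ℝ) ^ j) (hy : ∀ s, 0 ≤ y s ∧ y s < (n : ℝ) ^ j)
    (hne : ∀ t, y t ∉ planes δ a (-j) t) :
    dirDist s (modulatedCorner δ a j) y = |q - y s| := by
  refine (dirDist_le_abs_sub (setCoord_mem_modulatedCorner hn hq hq0 hy)).antisymm ?_
  refine le_csInf ⟨_, q - y s, setCoord_mem_modulatedCorner hn hq hq0 hy, rfl⟩ ?_
  rintro _ ⟨t, ht, rfl⟩
  obtain ⟨⟨u, hu⟩, hbox⟩ := (mem_modulatedCorner hn _ _ _ _).1 ht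
  rcases eq_or_ne u s with rfl | h
  · have hb := hbox u
    simp only [PiLp.add_apply, PiLp.smul_apply, PiLp.single_apply, if_true, smul_eq_mul,
      mul_one] at hu hb
    rw [eq_of_mem_planes_box hq hu hq0.1 hq0.2 hb.1 hb.2, add_sub_cancel_left]
  · exact absurd (by simpa [h] using hu) (hne u)

theorem exists_mem_samplingWithout (hn : 2 ≤ n) (i : Fin (d + 1)) (j : ℕ) (k s : Fin d) {q : ℝ}
    (hq : q ∈ planes (δ (i.succAbove k)) (a (i.succAbove k)) (-j) s)
    (hq0 : 0 ≤ q ∧ q < (n : ℝ) ^ j) :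
    ∃ y ∈ samplingWithout δ a i j, y s = q ∧
      ∀ t, ∃ k, y t ∈ planes (δ (i.succAbove k)) (a (i.succAbove k)) (-j) t := by
  obtain ⟨y, hys, hy1, hy2⟩ := exists_transversal
    (B := fun k t => {u | u ∈ planes (δ (i.succAbove k)) (a (i.succAbove k)) (-j) t ∧
      0 ≤ u ∧ u < (n : ℝ) ^ j})
    (fun k t => exists_mem_planes_box hn _ _ j t) k s ⟨hq, hq0⟩
  refine ⟨y, (mem_samplingWithout hn i j y).2 ⟨fun k => ?_, fun t => ?_⟩, hys, fun t => ?_⟩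
  · obtain ⟨t, ht⟩ := hy1 k
    exact ⟨t, ht.1⟩
  · obtain ⟨k, hk⟩ := hy2 t
    exact hk.2
  · obtain ⟨k, hk⟩ := hy2 t
    exact ⟨k, hk.1⟩

theorem samplingWithout_nonempty (hn : 2 ≤ n) (i : Fin (d + 1)) (j : ℕ) :
    (samplingWithout δ a i j).Nonempty := by
  rcases Nat.eq_zero_or_pos d with rfl | hd
  · exact ⟨0, (mem_samplingWithout hn i j _).2 ⟨fun k => k.elim0, fun s => s.elim0⟩⟩
  · obtain ⟨q, hq, hq0⟩ := exists_mem_planes_box hn (δ (i.succAbove ⟨0, hd⟩))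
      (a (i.succAbove ⟨0, hd⟩)) j ⟨0, hd⟩
    obtain ⟨y, hy, -⟩ := exists_mem_samplingWithout hn i j _ _ hq hq0
    exact ⟨y, hy⟩

theorem samplingWithout_finite (hn : 2 ≤ n) {i : Fin (d + 1)}
    (hsep : Separated fun k => δ (i.succAbove k)) (j : ℕ) :
    (samplingWithout δ a i j).Finite := by
  choose q hq hq0 using fun k s => exists_mem_planes_box hn (δ (i.succAbove k))
    (a (i.succAbove k)) j s
  refine ((Set.Finite.pi' fun t => Set.finite_range fun k => q k t).preimage
    (WithLp.ofLp_injective 2).injOn).subset fun y hy t => ?_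
  obtain ⟨hy1, hy2⟩ := (mem_samplingWithout hn i j y).1 hy
  obtain ⟨k, hk⟩ := exists_of_disjoint_of_transversal
    (B := fun k t => planes (δ (i.succAbove k)) (a (i.succAbove k)) (-j) t)
    (fun t k l u hk hl => by
      by_contra hkl
      exact planes_disjoint_of_sub_ne (hsep t k l hkl) hk hl) hy1 t
  exact ⟨k, eq_of_mem_planes_box (hq k t) hk (hq0 k t).1 (hq0 k t).2 (hy2 t).1 (hy2 t).2⟩

theorem dev_modulatedCorner_le (hn : 2 ≤ n) {δ y : EuclideanSpace ℝ (Fin d)}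
    {a : ℕ → Fin d → Fin n} {j : ℕ} (hy : ∀ s, 0 ≤ y s ∧ y s < (n : ℝ) ^ j) :
    dev (modulatedCorner δ a j) y ≤ (n : ℝ) ^ j := by
  refine Real.iSup_le (fun k => ?_) (by positivity)
  obtain ⟨q, hq, hq0⟩ := exists_mem_planes_box hn δ a j k
  refine (dirDist_le_abs_sub (setCoord_mem_modulatedCorner hn hq hq0 hy)).trans ?_
  rw [abs_le]
  constructor <;> linarith [(hy k).1, (hy k).2]

/-- Ensures that `sSup` in `normalizedMaxDev` is a true supremum and not the default value 0. -/
theorem bddAbove_dev_image (hn : 2 ≤ n) (i : Fin (d + 1)) (j : ℕ) :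
    BddAbove (dev (modulatedCorner (δ i) (a i) j) '' samplingWithout δ a i j) := by
  refine ⟨(n : ℝ) ^ j, ?_⟩
  rintro _ ⟨y, hy, rfl⟩
  exact dev_modulatedCorner_le hn ((mem_samplingWithout hn i j y).1 hy).2

theorem normalizedDist_nonneg (i : Fin (d + 1)) (j : ℕ) : 0 ≤ normalizedDist δ a i j :=
  div_nonneg (setDist_nonneg _ _) (by positivity)

theorem normalizedMaxDev_le_iff (hn : 2 ≤ n) (i : Fin (d + 1)) (j : ℕ) {r : ℝ} :
    normalizedMaxDev δ a i j ≤ r ↔ ∀ y ∈ samplingWithout δ a i j,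
      dev (modulatedCorner (δ i) (a i) j) y ≤ r * (n : ℝ) ^ j := by
  have hp : (0 : ℝ) < (n : ℝ) ^ j := pow_pos (by exact_mod_cast (by omega : 0 < n)) j
  rw [normalizedMaxDev, div_le_iff₀ hp, csSup_le_iff (bddAbove_dev_image hn i j)
    ((samplingWithout_nonempty hn i j).image _), Set.forall_mem_image]

theorem normalizedMaxDev_le_one (hn : 2 ≤ n) (i : Fin (d + 1)) (j : ℕ) :
    normalizedMaxDev δ a i j ≤ 1 := by
  rw [normalizedMaxDev_le_iff hn]
  intro y hy
  rw [one_mul]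
  exact dev_modulatedCorner_le hn ((mem_samplingWithout hn i j y).1 hy).2

theorem normalizedDist_le_normalizedMaxDev (hd : 1 ≤ d) (hn : 2 ≤ n) (i : Fin (d + 1)) (j : ℕ) :
    normalizedDist δ a i j ≤ normalizedMaxDev δ a i j := by
  obtain ⟨y, hy⟩ := samplingWithout_nonempty (δ := δ) (a := a) hn i j
  obtain ⟨q, hq, hq0⟩ := exists_mem_planes_box hn (δ i) (a i) j ⟨0, hd⟩
  unfold normalizedDist normalizedMaxDev
  gcongr
  exact ((setDist_le_dirDist (setCoord_mem_modulatedCorner hn hq hq0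
    ((mem_samplingWithout hn i j y).1 hy).2) hy).trans (dirDist_le_dev _ _ _)).trans
    (le_csSup (bddAbove_dev_image hn i j) ⟨y, hy, rfl⟩)

/-- The upper bound is the gap across the period: x ± nʲ are planes of the same grid and must also
keep away from y. -/
theorem Gap.abs_sub_mem {ε : ℝ} {j : ℕ} (h : Gap δ a ε (-j)) {s : Fin d} {i k : Fin (d + 1)}
    (hik : i ≠ k) {x y : ℝ} (hx : x ∈ planes (δ i) (a i) (-j) s)
    (hy : y ∈ planes (δ k) (a k) (-j) s) (hxy : |x - y| ≤ (n : ℝ) ^ j) :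
    ε * (n : ℝ) ^ j ≤ |x - y| ∧ |x - y| ≤ (1 - ε) * (n : ℝ) ^ j := by
  have key : ∀ z : ℤ, ε * (n : ℝ) ^ j ≤ |x + z * (n : ℝ) ^ j - y| := by
    intro z
    simpa using h s i k hik _ (add_mem_planes hx z) y hy
  have h0 := key 0
  have h1 := key 1
  have h2 := key (-1)
  simp only [Int.cast_zero, zero_mul, add_zero, Int.cast_one, one_mul, Int.cast_neg] at h0 h1 h2
  refine ⟨h0, ?_⟩
  rw [abs_le] at hxy ⊢
  rw [abs_of_nonneg (by linarith)] at h1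
  rw [abs_of_nonpos (by linarith)] at h2
  constructor <;> linarith

/-- Any two planes differ from their representatives in the box by multiples of nʲ. If the multiples
agree, the lower bound applies; otherwise the upper bound does. -/
theorem gap_of_abs_sub {ε : ℝ} {j : ℕ} (hn : 2 ≤ n)
    (h : ∀ s i k, i ≠ k → ∀ x ∈ planes (δ i) (a i) (-j) s, ∀ y ∈ planes (δ k) (a k) (-j) s,
      0 ≤ x ∧ x < (n : ℝ) ^ j → 0 ≤ y ∧ y < (n : ℝ) ^ j →
      ε * (n : ℝ) ^ j ≤ |x - y| ∧ |x - y| ≤ (1 - ε) * (n : ℝ) ^ j) : Gap δ a ε (-j) := by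
  intro s i k hik x hx y hy
  obtain ⟨p, hp, hp0⟩ := exists_mem_planes_box hn (δ i) (a i) j s
  obtain ⟨q, hq, hq0⟩ := exists_mem_planes_box hn (δ k) (a k) j s
  obtain ⟨h1, h2⟩ := h s i k hik p hp q hq hp0 hq0
  obtain ⟨z, hz⟩ := exists_sub_eq_of_mem_planes hx hp
  obtain ⟨w, hw⟩ := exists_sub_eq_of_mem_planes hy hq
  have hpos : (0 : ℝ) < (n : ℝ) ^ j := pow_pos (by exact_mod_cast (by omega : 0 < n)) j
  have hxy : x - y = p - q + ((z - w : ℤ) : ℝ) * (n : ℝ) ^ j := by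
    push_cast
    linarith
  rw [zpow_neg, zpow_natCast, div_inv_eq_mul, hxy]
  rw [abs_le] at h2
  rcases lt_trichotomy (z - w) 0 with hv | hv | hv
  · have hv' : ((z - w : ℤ) : ℝ) ≤ -1 := by exact_mod_cast (by omega : z - w ≤ -1)
    rw [le_abs]
    right
    nlinarith
  · simpa [hv] using h1
  · have hv' : (1 : ℝ) ≤ ((z - w : ℤ) : ℝ) := by exact_mod_cast (by omega : 1 ≤ z - w)
    rw [le_abs]
    left
    nlinarith

theorem Gap.exists_mem_planes_of_mem_samplingWithout (hn : 2 ≤ n) {ε : ℝ} (hε : 0 < ε) {j : ℕ}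
    (h : Gap δ a ε (-j)) {i : Fin (d + 1)} {y : EuclideanSpace ℝ (Fin d)}
    (hy : y ∈ samplingWithout δ a i j) (t : Fin d) :
    ∃ k, y t ∈ planes (δ (i.succAbove k)) (a (i.succAbove k)) (-j) t :=
  exists_of_disjoint_of_transversal
    (B := fun k t => planes (δ (i.succAbove k)) (a (i.succAbove k)) (-j) t)
    (fun t k l u hk hl => by simpa using h.not_mem hn hε hk hl)
    ((mem_samplingWithout hn i j y).1 hy).1 t

theorem abs_sub_le_pow {j : ℕ} {x y : ℝ} (hx : 0 ≤ x ∧ x < (n : ℝ) ^ j)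
    (hy : 0 ≤ y ∧ y < (n : ℝ) ^ j) : |x - y| ≤ (n : ℝ) ^ j := by
  rw [abs_le]
  constructor <;> linarith [hx.1, hx.2, hy.1, hy.2]

theorem Gap.le_normalizedDist (hd : 1 ≤ d) (hn : 2 ≤ n) {ε : ℝ} (hε : 0 < ε) {j : ℕ}
    (h : Gap δ a ε (-j)) (i : Fin (d + 1)) : ε ≤ normalizedDist δ a i j := by
  have hpos : (0 : ℝ) < (n : ℝ) ^ j := pow_pos (by exact_mod_cast (by omega : 0 < n)) j
  rw [normalizedDist, le_div_iff₀ hpos]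
  obtain ⟨y₀, hy₀⟩ := samplingWithout_nonempty (δ := δ) (a := a) hn i j
  refine le_setDist ?_ ⟨y₀, hy₀⟩ fun x hx y hy => ?_
  · obtain ⟨q, hq, hq0⟩ := exists_mem_planes_box hn (δ i) (a i) j ⟨0, hd⟩
    exact ⟨_, setCoord_mem_modulatedCorner hn hq hq0 ((mem_samplingWithout hn i j _).1 hy₀).2⟩
  · obtain ⟨⟨s, hs⟩, hx0⟩ := (mem_modulatedCorner hn _ _ _ _).1 hx
    obtain ⟨k, hk⟩ := h.exists_mem_planes_of_mem_samplingWithout hn hε hy s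
    have hy0 := ((mem_samplingWithout hn i j _).1 hy).2
    exact (h.abs_sub_mem (Fin.succAbove_ne i k).symm hs hk
      (abs_sub_le_pow (hx0 s) (hy0 s))).1.trans (abs_sub_le_norm x y s)

theorem Gap.normalizedMaxDev_le (hd : 1 ≤ d) (hn : 2 ≤ n) {ε : ℝ} (hε : 0 < ε) {j : ℕ}
    (h : Gap δ a ε (-j)) (i : Fin (d + 1)) : normalizedMaxDev δ a i j ≤ 1 - ε := by
  rw [normalizedMaxDev_le_iff hn]
  intro y hy
  have hy0 := ((mem_samplingWithout hn i j _).1 hy).2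
  have : Nonempty (Fin d) := ⟨⟨0, hd⟩⟩
  refine ciSup_le fun s => ?_
  obtain ⟨q, hq, hq0⟩ := exists_mem_planes_box hn (δ i) (a i) j s
  obtain ⟨k, hk⟩ := h.exists_mem_planes_of_mem_samplingWithout hn hε hy s
  exact (dirDist_le_abs_sub (setCoord_mem_modulatedCorner hn hq hq0 hy0)).trans
    (h.abs_sub_mem (Fin.succAbove_ne i k).symm hq hk (abs_sub_le_pow hq0 (hy0 s))).2

/-- Complete y to a sampling point with all coordinates on planes of the other grids. The set
distance then bounds |x - y| below. By separation |x - y| is exactly the deviation in direction s,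
hence bounded above. -/
theorem gap_of_normalized (hn : 2 ≤ n) {ε : ℝ} {j : ℕ}
    (hsep : ∀ i k, i ≠ k → ∀ s, ∀ z : ℤ, δ i s - δ k s ≠ z)
    (h1 : ∀ i, ε ≤ normalizedDist δ a i j) (h2 : ∀ i, normalizedMaxDev δ a i j ≤ 1 - ε) :
    Gap δ a ε (-j) := by
  have hpos : (0 : ℝ) < (n : ℝ) ^ j := pow_pos (by exact_mod_cast (by omega : 0 < n)) j
  refine gap_of_abs_sub hn fun s i k hik x hx y hy hx0 hy0 => ?_
  obtain ⟨k', rfl⟩ := Fin.exists_succAbove_eq hik.symm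
  obtain ⟨z, hz, rfl, hzt⟩ := exists_mem_samplingWithout hn i j k' s hy hy0
  have hz0 := ((mem_samplingWithout hn i j _).1 hz).2
  constructor
  · rw [← norm_setCoord_sub]
    exact ((le_div_iff₀ hpos).1 (h1 i)).trans
      (setDist_le (setCoord_mem_modulatedCorner hn hx hx0 hz0) hz)
  · rw [← dirDist_modulatedCorner hn hx hx0 hz0 fun t ht => ?_]
    · exact (dirDist_le_dev _ _ _).trans ((normalizedMaxDev_le_iff hn i j).1 (h2 i) z hz)
    · obtain ⟨k, hk⟩ := hzt t
      exact planes_disjoint_of_sub_ne (hsep _ _ (Fin.succAbove_ne i k).symm t) ht hk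

theorem Gap.mono_right {ε ε' : ℝ} {m m' : ℤ} (hn : 2 ≤ n) (h : Gap δ a ε m) (hm : m' ≤ m)
    (hε : ε' / (n : ℝ) ^ m' ≤ ε / (n : ℝ) ^ m) : Gap δ a ε' m' :=
  fun s i k hik x hx y hy => hε.trans
    (h s i k hik x (planes_mono hn _ _ s hm hx) y (planes_mono hn _ _ s hm hy))

theorem large_scale_of_gap (hd : 1 ≤ d) (hn : 2 ≤ n) {ε : ℝ} (hε : 0 < ε)
    (h : ∀ j : ℕ, Gap δ a ε (-j)) (i : Fin (d + 1)) :
    0 < Filter.liminf (normalizedDist δ a i) Filter.atTop ∧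
      Filter.liminf (normalizedDist δ a i) Filter.atTop ≤
        Filter.limsup (normalizedMaxDev δ a i) Filter.atTop ∧
      Filter.limsup (normalizedMaxDev δ a i) Filter.atTop < 1 := by
  have hle := normalizedDist_le_normalizedMaxDev (δ := δ) (a := a) hd hn i
  have hdist := fun j => (h j).le_normalizedDist hd hn hε i
  have hdev := fun j => (h j).normalizedMaxDev_le hd hn hε i
  -- In ℝ, comparing liminf and limsup requires explicit boundedness on both sides.
  have ub {f : ℕ → ℝ} (hf : ∀ j, f j ≤ 1 - ε) :
      Filter.atTop.IsBoundedUnder (· ≤ ·) f := Filter.isBoundedUnder_of ⟨_, hf⟩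
  have lb {f : ℕ → ℝ} (hf : ∀ j, ε ≤ f j) :
      Filter.atTop.IsBoundedUnder (· ≥ ·) f := Filter.isBoundedUnder_of ⟨_, hf⟩
  have hu1 := ub fun j => (hle j).trans (hdev j)
  have hu2 := ub hdev
  have hl1 := lb hdist
  have hl2 := lb fun j => (hdist j).trans (hle j)
  refine ⟨hε.trans_le ?_, ?_, lt_of_le_of_lt ?_ (sub_lt_self 1 hε)⟩
  · exact Filter.le_liminf_of_le hu1.isCoboundedUnder_ge (Filter.Eventually.of_forall hdist)
  · exact (Filter.liminf_le_liminf (Filter.Eventually.of_forall hle) hl1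
      hu2.isCoboundedUnder_ge).trans (Filter.liminf_le_limsup hu2 hl2)
  · exact Filter.limsup_le_of_le hl2.isCoboundedUnder_le (Filter.Eventually.of_forall hdev)

theorem gap_of_large_scale (hn : 2 ≤ n) {ε₀ : ℝ} (hε₀ : 0 < ε₀) (h₀ : Gap δ a ε₀ 0)
    (h1 : ∀ i, 0 < Filter.liminf (normalizedDist δ a i) Filter.atTop)
    (h2 : ∀ i, Filter.limsup (normalizedMaxDev δ a i) Filter.atTop < 1) :
    ∃ ε : ℝ, 0 < ε ∧ ∀ j : ℕ, Gap δ a ε (-j) := by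
  have hn1 : (1 : ℝ) ≤ n := by exact_mod_cast (by omega : 1 ≤ n)
  choose c hc0 hc1 using fun i => exists_between (h1 i)
  choose e he0 he1 using fun i => exists_between (h2 i)
  have hev : ∀ᶠ j in Filter.atTop, ∀ i, c i ≤ normalizedDist δ a i j ∧
      normalizedMaxDev δ a i j ≤ e i := by
    rw [Filter.eventually_all]
    intro i
    have hl : Filter.atTop.IsBoundedUnder (· ≥ ·) (normalizedDist δ a i) :=
      Filter.isBoundedUnder_of ⟨0, normalizedDist_nonneg i⟩
    have hu : Filter.atTop.IsBoundedUnder (· ≤ ·) (normalizedMaxDev δ a i) :=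
      Filter.isBoundedUnder_of ⟨1, normalizedMaxDev_le_one hn i⟩
    filter_upwards [Filter.eventually_lt_of_lt_liminf (hc1 i) hl,
      Filter.eventually_lt_of_limsup_lt (he0 i) hu] with j hj1 hj2
    exact ⟨hj1.le, hj2.le⟩
  obtain ⟨J, hJ⟩ := Filter.eventually_atTop.1 hev
  let r := Finset.univ.inf' Finset.univ_nonempty fun i => min (c i) (1 - e i)
  have hr : 0 < r := (Finset.lt_inf'_iff _).2 fun i _ => lt_min (hc0 i) (sub_pos.2 (he1 i))
  have hri : ∀ i, r ≤ min (c i) (1 - e i) := fun i => Finset.inf'_le _ (Finset.mem_univ i)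
  -- Levels j < J reuse the gap ε₀ of level 0; relative to the sidelength nʲ this loses a factor of
  -- at most n^J.
  refine ⟨min r (ε₀ / (n : ℝ) ^ J), lt_min hr (by positivity), fun j => ?_⟩
  rcases le_or_gt J j with hj | hj
  · refine gap_of_normalized hn (fun i k hik s z => h₀.separated hn hε₀ hik s z) (fun i => ?_)
      fun i => ?_
    · exact ((min_le_left _ _).trans ((hri i).trans (min_le_left _ _))).trans (hJ j hj i).1
    · have := (min_le_left r (ε₀ / (n : ℝ) ^ J)).trans ((hri i).trans (min_le_right _ _))
      linarith [(hJ j hj i).2]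
  · refine h₀.mono_right hn (by omega) ?_
    rw [zpow_neg, zpow_natCast, div_inv_eq_mul, zpow_zero, div_one]
    calc _ ≤ ε₀ / (n : ℝ) ^ J * (n : ℝ) ^ J := by
          gcongr
          exact min_le_right _ _
      _ = ε₀ := by field_simp

end NAdic

theorem theorem8p1 (d n : ℕ) (hd : 1 ≤ d) (hn : 2 ≤ n)
    (δ : Fin (d + 1) → EuclideanSpace ℝ (Fin d))
    (a : Fin (d + 1) → ℕ → Fin d → Fin n) :
    (NAdic.Adjacent (fun i => NAdic.grid (δ i) (a i)) ↔
      (∀ i, NAdic.IsFarVector n (δ i) (fun k => δ (i.succAbove k))) ∧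
      (∀ i,
        0 < Filter.liminf (NAdic.normalizedDist δ a i) Filter.atTop ∧
        Filter.liminf (NAdic.normalizedDist δ a i) Filter.atTop ≤
          Filter.limsup (NAdic.normalizedMaxDev δ a i) Filter.atTop ∧
        Filter.limsup (NAdic.normalizedMaxDev δ a i) Filter.atTop < 1)) ∧
    (∀ i, NAdic.Separated (fun k => δ (i.succAbove k)) → ∀ j : ℕ, 0 < j →
      (NAdic.samplingWithout δ a i j).Finite ∧
      ∃ y' ∈ NAdic.samplingWithout δ a i j, ∀ y ∈ NAdic.samplingWithout δ a i j,
        NAdic.dev (NAdic.modulatedCorner (δ i) (a i) j) y ≤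
          NAdic.dev (NAdic.modulatedCorner (δ i) (a i) j) y') := by
  refine ⟨⟨fun h => ?_, fun ⟨hfar, hlarge⟩ => ?_⟩, fun i hsep j _ => ?_⟩
  · obtain ⟨ε, hε, hgap⟩ := NAdic.gap_of_adjacent hn h
    exact ⟨NAdic.isFarVector_of_gap hd hn hε fun m => hgap m,
      NAdic.large_scale_of_gap hd hn hε fun j => hgap (-j)⟩
  · obtain ⟨ε, hε, hgap⟩ := NAdic.gap_of_isFarVector (a := a) hn hfar
    obtain ⟨ε', hε', hgap'⟩ := NAdic.gap_of_large_scale hn hε (hgap 0)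
      (fun i => (hlarge i).1) fun i => (hlarge i).2.2
    refine NAdic.adjacent_of_gap hn (lt_min hε hε') fun m => ?_
    have hp := NAdic.pow_pos_of_two_le hn m
    rcases Int.eq_nat_or_neg m with ⟨j, rfl | rfl⟩
    · exact (hgap j).mono_right hn le_rfl (by gcongr; exact min_le_left _ _)
    · exact (hgap' j).mono_right hn le_rfl (by gcongr; exact min_le_right _ _)
  · have hfin := NAdic.samplingWithout_finite (a := a) hn hsep j
    exact ⟨hfin, Set.exists_max_image _ _ hfin (NAdic.samplingWithout_nonempty hn i j)⟩
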